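/- Let $\mathbb{C}^q$ carry its standard flat metric and complex structure $J$. Let $d,l>0$ and let $(M^{d+l},g)$ be a smooth Riemannian manifold isometrically immersed in $\mathbb{C}^q$ as a CR-submanifold, i.e. such that $D_x=J(T_xM)\cap T_xM$ has the same real dimension $d$ at every point $x\in M$. Let $h$ be the second fundamental form of $M$ in $\mathbb{C}^q$; $M$ is called $D$-minimal if $H_D=\sum_{i=1}^d h(e_i,e_i)$ ($e_1,\dots,e_d$ an orthonormal basis of $D_x$) vanishes at every $x\in M$. Let $R_{X,Y}=\nabla_X\nabla_Y-\nabla_Y\nabla_X-\nabla_{[X,Y]}$ be the curvature tensor of the Levi-Civita connection of $g$. For mutually orthogonal subspaces $V_1,\dots,V_k$ ($k\ge 2$) of $T_xM$ put $$S_m(V_1,\dots,V_k)=\sum_{i<j}S_m(V_i,V_j),\qquad S_m(V_i,V_j)=\sum_{a,b} g(R_{e_a,e_b}e_b,e_a),$$ where $e_a$ and $e_b$ run over orthonormal bases of $V_i$ and $V_j$ respectively. Define $$\delta^+_{m,D}(n_1,\dots,n_k)(x)=\max S_m(V_1,\dots,V_k),\qquad \delta^-_{m,D}(n_1,\dots,n_k)(x)=\min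 S_m(V_1,\dots,V_k),$$ where $V_1,\dots,V_k$ run over the mutually orthogonal subspaces of $D_x$ with $\dim V_i=n_i$, and, for $2\le k\le d$, let $\delta^-_{m,D}(k)(x)$ be the minimum of $\delta^-_{m,D}(n_1,\dots,n_k)(x)$ over all positive integers $n_1,\dots,n_k$ with $\sum_i n_i\le d$. Corollary. There is no $D$-minimal CR-submanifold $M^{d+l}$ of $\mathbb{C}^q$ with either of the following properties: (a) $\delta^+_{m,D}(n_1,\dots,n_k)(x)>0$ for some $k\ge2$, some natural numbers $n_1,\dots,n_k$ with $\sum_i n_i=d$ and some point $x\in M$; (b) $\delta^-_{m,D}(k)(x)>0$ for some $k$ with $2\le k\le d$ and some point $x\in M$. -/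

import Mathlib

open Bundle
open scoped Manifold ContDiff InnerProductSpace

noncomputable section

/-- Complex Euclidean space `ℂ^q` with its standard Hermitian structure. -/
abbrev CSpace (q : ℕ) : Type := EuclideanSpace ℂ (Fin q)

/-- The standard complex structure `J` of `ℂ^q` (multiplication by `i`) as a real-linear map. -/
def complexStructure (q : ℕ) : CSpace q →ₗ[ℝ] CSpace q :=
  ((Complex.I • LinearMap.id : CSpace q →ₗ[ℂ] CSpace q)).restrictScalars ℝ

section Coordinates

/-! ### The Levi-Civita connection and the curvature tensor in coordinates

`G y` is the matrix `(g_{ij}(y))` of the metric coefficients at the point `y` of a coordinate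
domain in `ℝ^N`. -/

variable {N : ℕ}

/-- The partial derivative `∂_i F (y)`. -/
def partialDeriv (i : Fin N) (F : EuclideanSpace ℝ (Fin N) → ℝ)
    (y : EuclideanSpace ℝ (Fin N)) : ℝ :=
  fderiv ℝ F y (EuclideanSpace.single i 1)

/-- The Christoffel symbol
`Γ^k_{ij} = (1/2) ∑_l g^{kl} (∂_i g_{jl} + ∂_j g_{il} - ∂_l g_{ij})` at `y`. -/
def christoffel (G : EuclideanSpace ℝ (Fin N) → Matrix (Fin N) (Fin N) ℝ)
    (k i j : Fin N) (y : EuclideanSpace ℝ (Fin N)) : ℝ :=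
  (1 / 2 : ℝ) * ∑ l, (G y)⁻¹ k l *
    (partialDeriv i (fun z => G z j l) y + partialDeriv j (fun z => G z i l) y
      - partialDeriv l (fun z => G z i j) y)

/-- The component `R^m_{ijk}` of the curvature tensor, defined by
`R_{∂_i, ∂_j} ∂_k = ∑_m R^m_{ijk} ∂_m`,
where `R_{X,Y} = ∇_X ∇_Y - ∇_Y ∇_X - ∇_{[X,Y]}`. -/
def curvatureComponent (G : EuclideanSpace ℝ (Fin N) → Matrix (Fin N) (Fin N) ℝ)
    (m i j k : Fin N) (y : EuclideanSpace ℝ (Fin N)) : ℝ :=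
  partialDeriv i (christoffel G m j k) y - partialDeriv j (christoffel G m i k) y
    + ∑ p, (christoffel G m i p y * christoffel G p j k y
        - christoffel G m j p y * christoffel G p i k y)

end Coordinates

section Riemannian

variable {N : ℕ} {M : Type*} [TopologicalSpace M] [ChartedSpace (EuclideanSpace ℝ (Fin N)) M]

instance (x : M) : FiniteDimensional ℝ (TangentSpace (𝓡 N) x) :=
  inferInstanceAs (FiniteDimensional ℝ (EuclideanSpace ℝ (Fin N)))

/-- The coordinate vector `∂_i` of the preferred chart at `x`, at the point with coordinates `y`. -/
def coordVector (x : M) (i : Fin N) (y : EuclideanSpace ℝ (Fin N)) :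
    TangentSpace (𝓡 N) ((extChartAt (𝓡 N) x).symm y) :=
  mfderiv 𝓘(ℝ, EuclideanSpace ℝ (Fin N)) (𝓡 N) (extChartAt (𝓡 N) x).symm y
    (EuclideanSpace.single i 1)

/-- The components, with respect to the preferred chart at `x`, of a tangent vector at `x`. -/
def coordComponents (x : M) (u : TangentSpace (𝓡 N) x) : EuclideanSpace ℝ (Fin N) :=
  mfderiv (𝓡 N) 𝓘(ℝ, EuclideanSpace ℝ (Fin N)) (extChartAt (𝓡 N) x) x u

/-- The tangent vector at `x` whose components in the preferred chart at `x` are `c`. -/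
def ofCoordComponents (x : M) (c : EuclideanSpace ℝ (Fin N)) : TangentSpace (𝓡 N) x :=
  mfderiv 𝓘(ℝ, EuclideanSpace ℝ (Fin N)) (𝓡 N) (extChartAt (𝓡 N) x).symm
    (extChartAt (𝓡 N) x x) c

variable [RiemannianBundle (fun x : M => TangentSpace (𝓡 N) x)]

/-- The coefficients `g_{ij}` of the Riemannian metric in the preferred chart at `x`. -/
def metricCoeff (x : M) (y : EuclideanSpace ℝ (Fin N)) : Matrix (Fin N) (Fin N) ℝ :=
  Matrix.of fun i j => ⟪coordVector x i y, coordVector x j y⟫_ℝ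

/-- The curvature tensor `R_{u,v} w` at `x` of the Levi-Civita connection of the metric. -/
def curvature (x : M) (u v w : TangentSpace (𝓡 N) x) : TangentSpace (𝓡 N) x :=
  ofCoordComponents x <| WithLp.toLp 2 fun m => ∑ i, ∑ j, ∑ k,
    coordComponents x u i * coordComponents x v j * coordComponents x w k *
      curvatureComponent (metricCoeff x) m i j k (extChartAt (𝓡 N) x x)

/-- The mutual curvature `S_m(V, W) = ∑_{a,b} g(R_{e_a, e_b} e_b, e_a)` of two orthogonal subspaces
of a tangent space, where `e_a` runs over an orthonormal basis of `V` and `e_b` over one of `W`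
(the value does not depend on these bases). -/
def mutualCurvaturePair (x : M) (V W : Submodule ℝ (TangentSpace (𝓡 N) x)) : ℝ :=
  ∑ a, ∑ b, ⟪curvature x (stdOrthonormalBasis ℝ V a : TangentSpace (𝓡 N) x)
      (stdOrthonormalBasis ℝ W b) (stdOrthonormalBasis ℝ W b),
    (stdOrthonormalBasis ℝ V a : TangentSpace (𝓡 N) x)⟫_ℝ

/-- The mutual curvature `S_m(V_1, …, V_k) = ∑_{i<j} S_m(V_i, V_j)`. -/
def mutualCurvature (x : M) {k : ℕ} (V : Fin k → Submodule ℝ (TangentSpace (𝓡 N) x)) : ℝ :=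
  ∑ i, ∑ j ∈ Finset.Ioi i, mutualCurvaturePair x (V i) (V j)

/-- The values `S_m(V_1, …, V_k)`, where `V_1, …, V_k` run over the mutually orthogonal subspaces
of `D_x` with `dim V_i = n_i`. -/
def mutualCurvatureValues (x : M) (Dx : Submodule ℝ (TangentSpace (𝓡 N) x)) {k : ℕ}
    (n : Fin k → ℕ) : Set ℝ :=
  {s | ∃ V : Fin k → Submodule ℝ (TangentSpace (𝓡 N) x),
    (∀ i, V i ≤ Dx) ∧ (∀ i j, i ≠ j → V i ⟂ V j) ∧ (∀ i, Module.finrank ℝ (V i) = n i) ∧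
      s = mutualCurvature x V}

/-- The mutual curvature invariant `δ⁺_{m,D}(n_1, …, n_k)(x) = max S_m(V_1, …, V_k)`. -/
def deltaPlus (x : M) (Dx : Submodule ℝ (TangentSpace (𝓡 N) x)) {k : ℕ} (n : Fin k → ℕ) : ℝ :=
  sSup (mutualCurvatureValues x Dx n)

/-- The mutual curvature invariant `δ⁻_{m,D}(n_1, …, n_k)(x) = min S_m(V_1, …, V_k)`. -/
def deltaMinus (x : M) (Dx : Submodule ℝ (TangentSpace (𝓡 N) x)) {k : ℕ} (n : Fin k → ℕ) : ℝ :=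
  sInf (mutualCurvatureValues x Dx n)

/-- The invariant `δ⁻_{m,D}(k)(x) = min δ⁻_{m,D}(n_1, …, n_k)(x)`, where the minimum is over all
positive integers `n_1, …, n_k` with `n_1 + ⋯ + n_k ≤ dim D_x`. -/
def deltaMinusMin (x : M) (Dx : Submodule ℝ (TangentSpace (𝓡 N) x)) (k : ℕ) : ℝ :=
  sInf {s | ∃ n : Fin k → ℕ, (∀ i, 0 < n i) ∧ ∑ i, n i ≤ Module.finrank ℝ Dx ∧
    s = deltaMinus x Dx n}

end Riemannian

section Submanifold

variable (N : ℕ) {q : ℕ} {M : Type*} [TopologicalSpace M] [ChartedSpace (EuclideanSpace ℝ (Fin N)) M]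

/-- The differential `df_x : T_xM → ℂ^q`. -/
def differential (f : M → CSpace q) (x : M) : TangentSpace (𝓡 N) x →ₗ[ℝ] CSpace q :=
  (NormedSpace.fromTangentSpace (f x)).toLinearMap ∘ₗ
    (mfderiv (𝓡 N) 𝓘(ℝ, CSpace q) f x).toLinearMap

/-- The maximal `J`-invariant subspace `D_x = J(T_xM) ∩ T_xM` of the tangent space, where `T_xM` is
identified with its image in `ℂ^q` under `df_x`. -/
def holomorphicTangent (f : M → CSpace q) (x : M) : Submodule ℝ (TangentSpace (𝓡 N) x) :=
  ((LinearMap.range (differential N f x)).map (complexStructure q)).comap (differential N f x)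

/-- The second fundamental form `h(u, v)`: the normal component of the second derivative of `f`
in the preferred chart at `x`, evaluated on the components of `u` and `v`. -/
def secondFundamentalForm (f : M → CSpace q) (x : M) (u v : TangentSpace (𝓡 N) x) : CSpace q :=
  (LinearMap.range (differential N f x))ᗮ.starProjection
    (fderiv ℝ (fderiv ℝ (f ∘ (extChartAt (𝓡 N) x).symm)) (extChartAt (𝓡 N) x x)
      (coordComponents x u) (coordComponents x v))

variable [RiemannianBundle (fun x : M => TangentSpace (𝓡 N) x)]

/-- `f : M → ℂ^q` is a smooth isometric immersion, i.e. `(M, g)` is a (possibly immersed)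
Riemannian submanifold of `ℂ^q`. -/
structure IsIsometricImmersion (f : M → CSpace q) : Prop where
  contMDiff : ContMDiff (𝓡 N) 𝓘(ℝ, CSpace q) ∞ f
  isometric : ∀ (x : M) (u v : TangentSpace (𝓡 N) x),
    ⟪differential N f x u, differential N f x v⟫_ℝ = ⟪u, v⟫_ℝ

/-- The mean curvature vector `H_V = ∑_i h(e_i, e_i)` of a subspace `V` of `T_xM`, where `e_i` is an
orthonormal basis of `V` (the value does not depend on the basis). -/
def meanCurvature (f : M → CSpace q) (x : M) (V : Submodule ℝ (TangentSpace (𝓡 N) x)) : CSpace q :=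
  ∑ i, secondFundamentalForm N f x (stdOrthonormalBasis ℝ V i) (stdOrthonormalBasis ℝ V i)

/-- The isometrically immersed submanifold `M` is `D`-minimal: `H_D ≡ 0`. -/
def IsDMinimal (f : M → CSpace q) : Prop :=
  ∀ x : M, meanCurvature N f x (holomorphicTangent N f x) = 0

end Submanifold

/-- `f` presents the Riemannian manifold `M` of dimension `d + l`, with `d, l > 0`, as a
CR-submanifold of `ℂ^q`: it is an isometric immersion and `D = J(TM) ∩ TM` has constant real
dimension `d`. -/
structure IsCRSubmanifold (d l : ℕ) {q : ℕ} {M : Type*} [TopologicalSpace M]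
    [ChartedSpace (EuclideanSpace ℝ (Fin (d + l))) M]
    [RiemannianBundle (fun x : M => TangentSpace (𝓡 (d + l)) x)] (f : M → CSpace q) : Prop where
  d_pos : 0 < d
  l_pos : 0 < l
  isometricImmersion : IsIsometricImmersion (d + l) f
  finrank_eq : ∀ x : M, Module.finrank ℝ (holomorphicTangent (d + l) f x) = d

end

/-! Since the ambient space is flat, the Gauss equation reads g(R_{a,b} b, a) = ⟪h(a,a), h(b,b)⟫ -
|h(a,b)|². Summing over orthonormal bases and dropping the squares gives S_m(V, W) ≤ ⟪H_V, H_W⟫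
(`mutualCurvaturePair_le_inner_meanCurvature`). If the V_i decompose D orthogonally, the trace of h
over D splits, so the H_{V_i} add up to H_D = 0. Then 2 ∑_{i<j} ⟪H_{V_i}, H_{V_j}⟫ = |∑ H_{V_i}|² -
∑ |H_{V_i}|² ≤ 0, so every full decomposition has nonpositive mutual curvature
(`mutualCurvature_nonpos`). This bounds the maximum in (a). In (b) a positive minimum would force a
positive value on some decomposition with dimensions adding up to d.

Most of the work is the Gauss equation, because the curvature is given by Christoffel symbols in a
chart. There the metric is the Gram matrix of the partial derivatives of a parametrization F. The
lowered Christoffel symbols are ⟪F_ij, F_l⟫. Differentiating this identity once more and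
antisymmetrizing removes the third derivatives and leaves products of normal parts of second
derivatives (`gauss_equation_components`). -/

/-! ### Differentiability of determinants and inverse matrices. -/

open Filter Topology in
theorem DifferentiableAt.matrix_det {E n : Type*} [NormedAddCommGroup E] [NormedSpace ℝ E]
    [Fintype n] [DecidableEq n] {A : E → Matrix n n ℝ} {y : E}
    (hA : ∀ i j, DifferentiableAt ℝ (fun z => A z i j) y) :
    DifferentiableAt ℝ (fun z => (A z).det) y := by
  simp only [Matrix.det_apply]
  refine DifferentiableAt.fun_sum fun σ _ => ?_
  refine DifferentiableAt.fun_const_smul (c := Equiv.Perm.sign σ) ?_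
  have := fun i => hA (σ i) i
  fun_prop

/-- Cramer's rule: each entry of the inverse is a quotient of determinants. It is applied to the
inverse metric in the Christoffel symbols. -/
theorem DifferentiableAt.matrix_inv_apply {E n : Type*} [NormedAddCommGroup E] [NormedSpace ℝ E]
    [Fintype n] [DecidableEq n] {A : E → Matrix n n ℝ} {y : E}
    (hA : ∀ i j, DifferentiableAt ℝ (fun z => A z i j) y) (hdet : (A y).det ≠ 0) (k l : n) :
    DifferentiableAt ℝ (fun z => (A z)⁻¹ k l) y := by
  simp only [Matrix.inv_def, Matrix.smul_apply, Ring.inverse_eq_inv', smul_eq_mul,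
    Matrix.adjugate_apply]
  refine ((DifferentiableAt.matrix_det hA).inv hdet).mul (DifferentiableAt.matrix_det fun i j => ?_)
  by_cases h : i = l
  · subst h; simp
  · simpa [Matrix.updateRow_ne h] using hA i j

/-! ### The Gauss equation for a parametrization of a submanifold of an inner product space. -/

section Gauss

open Filter Topology

variable {N : ℕ} {W : Type*} [NormedAddCommGroup W] [InnerProductSpace ℝ W]

/-- The Gram matrix of the partial derivatives of a parametrization `F`. -/
noncomputable def parametrizationGram (F : EuclideanSpace ℝ (Fin N) → W)
    (y : EuclideanSpace ℝ (Fin N)) :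
    Matrix (Fin N) (Fin N) ℝ :=
  Matrix.gram ℝ fun i => fderiv ℝ F y (EuclideanSpace.single i 1)

theorem parametrizationGram_apply (F : EuclideanSpace ℝ (Fin N) → W)
    (y : EuclideanSpace ℝ (Fin N)) (i j : Fin N) :
    parametrizationGram F y i j =
      ⟪fderiv ℝ F y (EuclideanSpace.single i 1), fderiv ℝ F y (EuclideanSpace.single j 1)⟫_ℝ := rfl

theorem det_parametrizationGram_ne_zero {F : EuclideanSpace ℝ (Fin N) → W}
    {y : EuclideanSpace ℝ (Fin N)} (h : Function.Injective (fderiv ℝ F y)) :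
    (parametrizationGram F y).det ≠ 0 := by
  refine Matrix.det_gram_ne_zero_iff_linearIndependent.2 ?_
  have h1 := (EuclideanSpace.basisFun (Fin N) ℝ).toBasis.linearIndependent.map'
    (fderiv ℝ F y).toLinearMap (LinearMap.ker_eq_bot.2 h)
  simpa [Function.comp_def] using h1

theorem fderiv_clm_apply_const {E V X : Type*} [NormedAddCommGroup E] [NormedSpace ℝ E]
    [NormedAddCommGroup V] [NormedSpace ℝ V] [NormedAddCommGroup X] [NormedSpace ℝ X]
    {L : E → V →L[ℝ] X} {y : E}
    (hL : DifferentiableAt ℝ L y) (v : V) (u : E) :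
    fderiv ℝ (fun z => L z v) y u = fderiv ℝ L y u v := by
  rw [fderiv_clm_apply hL (differentiableAt_const v)]
  simp

theorem partialDeriv_inner {A B : EuclideanSpace ℝ (Fin N) → W} {y : EuclideanSpace ℝ (Fin N)}
    (hA : DifferentiableAt ℝ A y) (hB : DifferentiableAt ℝ B y) (i : Fin N) :
    partialDeriv i (fun z => ⟪A z, B z⟫_ℝ) y =
      ⟪A y, fderiv ℝ B y (EuclideanSpace.single i 1)⟫_ℝ +
      ⟪fderiv ℝ A y (EuclideanSpace.single i 1), B y⟫_ℝ :=
  fderiv_inner_apply (𝕜 := ℝ) hA hB _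

theorem partialDeriv_congr {A B : EuclideanSpace ℝ (Fin N) → ℝ} {y : EuclideanSpace ℝ (Fin N)}
    (h : A =ᶠ[𝓝 y] B) (i : Fin N) : partialDeriv i A y = partialDeriv i B y := by
  rw [partialDeriv, partialDeriv, h.fderiv_eq]

theorem partialDeriv_sum {ι : Type*} (s : Finset ι) {A : ι → EuclideanSpace ℝ (Fin N) → ℝ}
    {y : EuclideanSpace ℝ (Fin N)}
    (h : ∀ m ∈ s, DifferentiableAt ℝ (A m) y) (i : Fin N) :
    partialDeriv i (fun z => ∑ m ∈ s, A m z) y = ∑ m ∈ s, partialDeriv i (A m) y := by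
  simp only [partialDeriv]
  rw [fderiv_fun_sum h]
  simp

theorem partialDeriv_mul {A B : EuclideanSpace ℝ (Fin N) → ℝ} {y : EuclideanSpace ℝ (Fin N)}
    (hA : DifferentiableAt ℝ A y) (hB : DifferentiableAt ℝ B y) (i : Fin N) :
    partialDeriv i (fun z => A z * B z) y = A y * partialDeriv i B y + B y * partialDeriv i A y := by
  simp only [partialDeriv]
  rw [fderiv_fun_mul hA hB]
  simp

variable {F : EuclideanSpace ℝ (Fin N) → W} {y : EuclideanSpace ℝ (Fin N)}

theorem differentiableAt_fderiv_of_contDiffAt {E X : Type*} [NormedAddCommGroup E]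
    [NormedSpace ℝ E] [NormedAddCommGroup X] [NormedSpace ℝ X] {F : E → X} {y : E}
    (hF : ContDiffAt ℝ 2 F y) : DifferentiableAt ℝ (fderiv ℝ F) y :=
  (hF.fderiv_right (m := 1) (by norm_num)).differentiableAt (by norm_num)

theorem differentiableAt_parametrizationGram_apply (hF : ContDiffAt ℝ 2 F y) (i j : Fin N) :
    DifferentiableAt ℝ (fun z => parametrizationGram F z i j) y := by
  have h := differentiableAt_fderiv_of_contDiffAt hF
  simp only [parametrizationGram_apply]
  refine DifferentiableAt.inner ℝ ?_ ?_ <;> fun_prop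

theorem partialDeriv_parametrizationGram (hF : ContDiffAt ℝ 2 F y) (i j l : Fin N) :
    partialDeriv i (fun z => parametrizationGram F z j l) y =
      ⟪fderiv ℝ F y (EuclideanSpace.single j 1),
        fderiv ℝ (fderiv ℝ F) y (EuclideanSpace.single i 1) (EuclideanSpace.single l 1)⟫_ℝ +
      ⟪fderiv ℝ (fderiv ℝ F) y (EuclideanSpace.single i 1) (EuclideanSpace.single j 1),
        fderiv ℝ F y (EuclideanSpace.single l 1)⟫_ℝ := by
  have h := differentiableAt_fderiv_of_contDiffAt hF
  simp only [parametrizationGram_apply]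
  rw [partialDeriv_inner (by fun_prop) (by fun_prop), fderiv_clm_apply_const h,
    fderiv_clm_apply_const h]

/-- The three metric derivatives give six inner products. By symmetry of the second derivative four
of them cancel and the other two coincide, which absorbs the factor 1/2. -/
theorem christoffel_parametrizationGram (hF : ContDiffAt ℝ 2 F y) (k i j : Fin N) :
    christoffel (parametrizationGram F) k i j y = ∑ l, (parametrizationGram F y)⁻¹ k l *
      ⟪fderiv ℝ (fderiv ℝ F) y (EuclideanSpace.single i 1) (EuclideanSpace.single j 1),
        fderiv ℝ F y (EuclideanSpace.single l 1)⟫_ℝ := by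
  have hs : IsSymmSndFDerivAt ℝ F y := hF.isSymmSndFDerivAt (by simp)
  rw [christoffel, Finset.mul_sum]
  refine Finset.sum_congr rfl fun l _ => ?_
  rw [partialDeriv_parametrizationGram hF, partialDeriv_parametrizationGram hF,
    partialDeriv_parametrizationGram hF,
    hs.eq (EuclideanSpace.single j 1) (EuclideanSpace.single i 1),
    hs.eq (EuclideanSpace.single l 1) (EuclideanSpace.single j 1),
    hs.eq (EuclideanSpace.single l 1) (EuclideanSpace.single i 1),
    real_inner_comm (fderiv ℝ F y (EuclideanSpace.single j 1))]
  ring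

/-- Lowering the index cancels the inverse metric, leaving an identity that can be differentiated
without differentiating an inverse matrix. -/
theorem sum_christoffel_mul_parametrizationGram (hF : ContDiffAt ℝ 2 F y)
    (hdet : (parametrizationGram F y).det ≠ 0) (l i j : Fin N) :
    ∑ m, christoffel (parametrizationGram F) m i j y * parametrizationGram F y m l =
      ⟪fderiv ℝ (fderiv ℝ F) y (EuclideanSpace.single i 1) (EuclideanSpace.single j 1),
        fderiv ℝ F y (EuclideanSpace.single l 1)⟫_ℝ := by
  set b : Fin N → ℝ := fun l =>
    ⟪fderiv ℝ (fderiv ℝ F) y (EuclideanSpace.single i 1) (EuclideanSpace.single j 1),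
        fderiv ℝ F y (EuclideanSpace.single l 1)⟫_ℝ with hb
  have h1 : (fun m => christoffel (parametrizationGram F) m i j y) =
      (parametrizationGram F y)⁻¹.mulVec b := by
    ext m
    rw [christoffel_parametrizationGram hF]
    rfl
  have h2 : (parametrizationGram F y).mulVec
      (fun m => christoffel (parametrizationGram F) m i j y) = b := by
    rw [h1, Matrix.mulVec_mulVec, Matrix.mul_nonsing_inv _ hdet.isUnit, Matrix.one_mulVec]
  have h3 := congrFun h2 l
  rw [Matrix.mulVec, dotProduct] at h3
  change _ = b l
  rw [← h3]
  refine Finset.sum_congr rfl fun m _ => ?_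
  rw [mul_comm, parametrizationGram_apply, parametrizationGram_apply, real_inner_comm]

theorem differentiableAt_christoffel_parametrizationGram (hF : ContDiffAt ℝ 3 F y)
    (hdet : (parametrizationGram F y).det ≠ 0) (k i j : Fin N) :
    DifferentiableAt ℝ (christoffel (parametrizationGram F) k i j) y := by
  have hF2 : ContDiffAt ℝ 2 F y := hF.of_le (by norm_num)
  have hev : christoffel (parametrizationGram F) k i j =ᶠ[𝓝 y] fun z =>
      ∑ l, (parametrizationGram F z)⁻¹ k l *
      ⟪fderiv ℝ (fderiv ℝ F) z (EuclideanSpace.single i 1) (EuclideanSpace.single j 1),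
        fderiv ℝ F z (EuclideanSpace.single l 1)⟫_ℝ := by
    filter_upwards [hF2.eventually (by norm_num)] with z hz
    exact christoffel_parametrizationGram hz k i j
  refine DifferentiableAt.congr_of_eventuallyEq ?_ hev
  have h1 := differentiableAt_fderiv_of_contDiffAt hF2
  have h2 : DifferentiableAt ℝ (fderiv ℝ (fderiv ℝ F)) y :=
    differentiableAt_fderiv_of_contDiffAt (hF.fderiv_right (m := 2) (by norm_num))
  have h3 (l : Fin N) : DifferentiableAt ℝ (fun z => (parametrizationGram F z)⁻¹ k l) y :=
    DifferentiableAt.matrix_inv_apply (differentiableAt_parametrizationGram_apply hF2) hdet k l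
  refine DifferentiableAt.fun_sum fun l _ => (h3 l).fun_mul (DifferentiableAt.inner ℝ ?_ ?_)
  · exact (h2.clm_apply (differentiableAt_const _)).clm_apply (differentiableAt_const _)
  · exact h1.clm_apply (differentiableAt_const _)

/-- The tangential part of a second derivative is given by the Christoffel symbols. -/
theorem starProjection_orthogonal_range_fderiv_fderiv (hF : ContDiffAt ℝ 2 F y)
    (hdet : (parametrizationGram F y).det ≠ 0) (i j : Fin N) :
    (LinearMap.range (fderiv ℝ F y).toLinearMap)ᗮ.starProjection
      (fderiv ℝ (fderiv ℝ F) y (EuclideanSpace.single i 1) (EuclideanSpace.single j 1)) =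
    fderiv ℝ (fderiv ℝ F) y (EuclideanSpace.single i 1) (EuclideanSpace.single j 1) -
      ∑ m, christoffel (parametrizationGram F) m i j y •
        fderiv ℝ F y (EuclideanSpace.single m 1) := by
  refine Submodule.eq_starProjection_of_mem_orthogonal ?_ ?_
  · rw [Submodule.mem_orthogonal']
    rintro _ ⟨v, rfl⟩
    have hv : v = ∑ l, v l • EuclideanSpace.single l (1 : ℝ) := by
      simpa using ((EuclideanSpace.basisFun (Fin N) ℝ).sum_repr v).symm
    rw [hv, map_sum, inner_sum]
    refine Finset.sum_eq_zero fun l _ => ?_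
    rw [map_smul, inner_smul_right, ContinuousLinearMap.coe_coe, inner_sub_left, sum_inner,
      ← sum_christoffel_mul_parametrizationGram hF hdet l i j]
    simp [inner_smul_left, parametrizationGram_apply]
  · rw [sub_sub_cancel]
    refine Submodule.le_orthogonal_orthogonal _ ?_
    refine Submodule.sum_mem _ fun m _ => Submodule.smul_mem _ _ ⟨_, rfl⟩

/-- Obtained by differentiating Γ_{jk,l} = ⟪F_jk, F_l⟫ in direction i. The metric derivative on the
left supplies the tangential part of F_jk, so that only its normal part remains paired with F_il.
The other new term is symmetric in i and j and will cancel in the curvature. -/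
theorem sum_partialDeriv_christoffel_mul (hF : ContDiffAt ℝ 3 F y)
    (hdet : (parametrizationGram F y).det ≠ 0) (i j k l : Fin N) :
    ∑ m, (partialDeriv i (christoffel (parametrizationGram F) m j k) y +
        ∑ p, christoffel (parametrizationGram F) m i p y *
          christoffel (parametrizationGram F) p j k y) * parametrizationGram F y m l =
      ⟪fderiv ℝ (fderiv ℝ (fderiv ℝ F)) y (EuclideanSpace.single i 1)
          (EuclideanSpace.single j 1) (EuclideanSpace.single k 1),
        fderiv ℝ F y (EuclideanSpace.single l 1)⟫_ℝ +
      ⟪(LinearMap.range (fderiv ℝ F y).toLinearMap)ᗮ.starProjection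
          (fderiv ℝ (fderiv ℝ F) y (EuclideanSpace.single j 1) (EuclideanSpace.single k 1)),
        fderiv ℝ (fderiv ℝ F) y (EuclideanSpace.single i 1) (EuclideanSpace.single l 1)⟫_ℝ := by
  have hF2 : ContDiffAt ℝ 2 F y := hF.of_le (by norm_num)
  have h1 := differentiableAt_fderiv_of_contDiffAt hF2
  have h2 : DifferentiableAt ℝ (fderiv ℝ (fderiv ℝ F)) y :=
    differentiableAt_fderiv_of_contDiffAt (hF.fderiv_right (m := 2) (by norm_num))
  have hΓ := differentiableAt_christoffel_parametrizationGram hF hdet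
  have hG := differentiableAt_parametrizationGram_apply hF2
  -- The lowered identity is to be differentiated, so it is needed on a neighbourhood; nondegeneracy
  -- is an open condition.
  have hdet' : ∀ᶠ z in 𝓝 y, (parametrizationGram F z).det ≠ 0 :=
    (DifferentiableAt.matrix_det hG).continuousAt.eventually_ne hdet
  have hev : (fun z => ∑ m, christoffel (parametrizationGram F) m j k z *
      parametrizationGram F z m l) =ᶠ[𝓝 y] fun z =>
      ⟪fderiv ℝ (fderiv ℝ F) z (EuclideanSpace.single j 1) (EuclideanSpace.single k 1),
        fderiv ℝ F z (EuclideanSpace.single l 1)⟫_ℝ := by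
    filter_upwards [hF2.eventually (by norm_num), hdet'] with z hz hz'
    exact sum_christoffel_mul_parametrizationGram hz hz' l j k
  have key := partialDeriv_congr hev i
  rw [partialDeriv_inner (by fun_prop) (by fun_prop),
    partialDeriv_sum _ (fun m _ => (hΓ m j k).fun_mul (hG m l)), fderiv_clm_apply_const h1,
    fderiv_clm_apply_const (L := fun z => fderiv ℝ (fderiv ℝ F) z (EuclideanSpace.single j 1))
      (by fun_prop), fderiv_clm_apply_const h2] at key
  simp only [partialDeriv_mul (hΓ _ j k) (hG _ l), partialDeriv_parametrizationGram hF2] at key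
  rw [starProjection_orthogonal_range_fderiv_fderiv hF2 hdet, inner_sub_left, sum_inner]
  simp only [inner_smul_left, RCLike.conj_to_real]
  -- Lowering the index m turns the quadratic Christoffel term into the one produced by the
  -- derivative of the metric.
  have h3 : ∑ m, (∑ p, christoffel (parametrizationGram F) m i p y *
          christoffel (parametrizationGram F) p j k y) * parametrizationGram F y m l =
      ∑ p, christoffel (parametrizationGram F) p j k y *
        ⟪fderiv ℝ (fderiv ℝ F) y (EuclideanSpace.single i 1) (EuclideanSpace.single p 1),
          fderiv ℝ F y (EuclideanSpace.single l 1)⟫_ℝ := by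
    simp only [← sum_christoffel_mul_parametrizationGram hF2 hdet, Finset.sum_mul, Finset.mul_sum]
    rw [Finset.sum_comm]
    refine Finset.sum_congr rfl fun p _ => Finset.sum_congr rfl fun m _ => by ring
  simp only [mul_add, Finset.sum_add_distrib] at key
  simp only [add_mul, Finset.sum_add_distrib]
  rw [h3]
  have h4 : ∑ m, partialDeriv i (christoffel (parametrizationGram F) m j k) y *
      parametrizationGram F y m l = ∑ m, parametrizationGram F y m l *
        partialDeriv i (christoffel (parametrizationGram F) m j k) y :=
    Finset.sum_congr rfl fun _ _ => mul_comm _ _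
  rw [h4]
  linarith

/-- The Gauss equation for a parametrized submanifold of a Euclidean space, in components. -/
theorem gauss_equation_components (hF : ContDiffAt ℝ 3 F y)
    (hdet : (parametrizationGram F y).det ≠ 0) (i j k l : Fin N) :
    ∑ m, curvatureComponent (parametrizationGram F) m i j k y * parametrizationGram F y m l =
      ⟪(LinearMap.range (fderiv ℝ F y).toLinearMap)ᗮ.starProjection
          (fderiv ℝ (fderiv ℝ F) y (EuclideanSpace.single j 1) (EuclideanSpace.single k 1)),
        fderiv ℝ (fderiv ℝ F) y (EuclideanSpace.single i 1) (EuclideanSpace.single l 1)⟫_ℝ -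
      ⟪(LinearMap.range (fderiv ℝ F y).toLinearMap)ᗮ.starProjection
          (fderiv ℝ (fderiv ℝ F) y (EuclideanSpace.single i 1) (EuclideanSpace.single k 1)),
        fderiv ℝ (fderiv ℝ F) y (EuclideanSpace.single j 1) (EuclideanSpace.single l 1)⟫_ℝ := by
  -- Symmetry of the third derivative in its first two arguments is what cancels the third-order
  -- terms.
  have hs : IsSymmSndFDerivAt ℝ (fderiv ℝ F) y :=
    (hF.fderiv_right (m := 2) (by norm_num)).isSymmSndFDerivAt (by simp)
  have h1 := sum_partialDeriv_christoffel_mul hF hdet i j k l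
  have h2 := sum_partialDeriv_christoffel_mul hF hdet j i k l
  rw [hs.eq (EuclideanSpace.single j 1) (EuclideanSpace.single i 1)] at h2
  rw [← sub_eq_of_eq_add' h1, ← sub_eq_of_eq_add' h2, sub_sub_sub_cancel_right,
    ← Finset.sum_sub_distrib]
  refine Finset.sum_congr rfl fun m _ => ?_
  rw [curvatureComponent, Finset.sum_sub_distrib]
  ring

/-- The Gauss equation for a parametrized submanifold of a Euclidean space. -/
theorem gauss_equation_parametrization (hF : ContDiffAt ℝ 3 F y)
    (hdet : (parametrizationGram F y).det ≠ 0) (u v w z : EuclideanSpace ℝ (Fin N)) :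
    ⟪fderiv ℝ F y (WithLp.toLp 2 fun m => ∑ i, ∑ j, ∑ k, u i * v j * w k *
        curvatureComponent (parametrizationGram F) m i j k y), fderiv ℝ F y z⟫_ℝ =
      ⟪(LinearMap.range (fderiv ℝ F y).toLinearMap)ᗮ.starProjection
          (fderiv ℝ (fderiv ℝ F) y v w), fderiv ℝ (fderiv ℝ F) y u z⟫_ℝ -
      ⟪(LinearMap.range (fderiv ℝ F y).toLinearMap)ᗮ.starProjection
          (fderiv ℝ (fderiv ℝ F) y u w), fderiv ℝ (fderiv ℝ F) y v z⟫_ℝ := by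
  have hexp (v : EuclideanSpace ℝ (Fin N)) : v = ∑ l, v l • EuclideanSpace.single l (1 : ℝ) := by
    simpa using ((EuclideanSpace.basisFun (Fin N) ℝ).sum_repr v).symm
  have hl : ⟪fderiv ℝ F y (WithLp.toLp 2 fun m => ∑ i, ∑ j, ∑ k, u i * v j * w k *
        curvatureComponent (parametrizationGram F) m i j k y), fderiv ℝ F y z⟫_ℝ =
      ∑ i, ∑ j, ∑ k, ∑ l, u i * v j * w k * z l *
        ∑ m, curvatureComponent (parametrizationGram F) m i j k y *
          parametrizationGram F y m l := by
    conv_lhs => rw [hexp z, hexp (WithLp.toLp 2 _)]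
    simp only [map_sum, map_smul, sum_inner, inner_sum, inner_smul_left, inner_smul_right,
      RCLike.conj_to_real, ← parametrizationGram_apply, Finset.mul_sum, Finset.sum_mul]
    rw [Finset.sum_comm_cycle]
    refine Finset.sum_congr rfl fun i _ => ?_
    rw [Finset.sum_comm_cycle]
    refine Finset.sum_congr rfl fun j _ => ?_
    rw [Finset.sum_comm_cycle]
    refine Finset.sum_congr rfl fun k _ => Finset.sum_congr rfl fun l _ =>
      Finset.sum_congr rfl fun m _ => by ring
  have hr (u v w z : EuclideanSpace ℝ (Fin N)) :
      ⟪(LinearMap.range (fderiv ℝ F y).toLinearMap)ᗮ.starProjection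
          (fderiv ℝ (fderiv ℝ F) y v w), fderiv ℝ (fderiv ℝ F) y u z⟫_ℝ =
      ∑ i, ∑ j, ∑ k, ∑ l, u i * v j * w k * z l *
       ⟪(LinearMap.range (fderiv ℝ F y).toLinearMap)ᗮ.starProjection
          (fderiv ℝ (fderiv ℝ F) y (EuclideanSpace.single j 1) (EuclideanSpace.single k 1)),
        fderiv ℝ (fderiv ℝ F) y (EuclideanSpace.single i 1) (EuclideanSpace.single l 1)⟫_ℝ := by
    conv_lhs => rw [hexp u, hexp v, hexp w, hexp z]
    simp only [map_sum, map_smul, sum_inner, inner_sum, inner_smul_left, inner_smul_right,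
      RCLike.conj_to_real, sum_apply, smul_apply,
      Finset.mul_sum]
    rw [Finset.sum_comm]
    refine Finset.sum_congr rfl fun i _ => ?_
    rw [Finset.sum_comm, Finset.sum_comm_cycle]
    refine Finset.sum_congr rfl fun j _ => Finset.sum_congr rfl fun k _ =>
      Finset.sum_congr rfl fun l _ => by ring
  rw [hl, hr u v w z, hr v u w z]
  simp only [gauss_equation_components hF hdet, mul_sub, Finset.sum_sub_distrib]
  congr 1
  rw [Finset.sum_comm]
  refine Finset.sum_congr rfl fun i _ => Finset.sum_congr rfl fun j _ =>
    Finset.sum_congr rfl fun k _ => Finset.sum_congr rfl fun l _ => by ring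

end Gauss

/-! ### Locality of the curvature, and transfer from charts to the manifold. -/

open Filter Topology in
theorem christoffel_eventuallyEq {N : ℕ}
    {G G' : EuclideanSpace ℝ (Fin N) → Matrix (Fin N) (Fin N) ℝ}
    {y : EuclideanSpace ℝ (Fin N)} (h : G =ᶠ[𝓝 y] G') (k i j : Fin N) :
    christoffel G k i j =ᶠ[𝓝 y] christoffel G' k i j := by
  filter_upwards [h.eventually_nhds] with z hz
  have hd (a b c : Fin N) : partialDeriv a (fun t => G t b c) z =
      partialDeriv a (fun t => G' t b c) z :=
    partialDeriv_congr (hz.mono fun t ht => by simp only [ht]) a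
  simp only [christoffel, hd, hz.self_of_nhds]

open Filter Topology in
theorem curvatureComponent_congr {N : ℕ}
    {G G' : EuclideanSpace ℝ (Fin N) → Matrix (Fin N) (Fin N) ℝ}
    {y : EuclideanSpace ℝ (Fin N)} (h : G =ᶠ[𝓝 y] G') (m i j k : Fin N) :
    curvatureComponent G m i j k y = curvatureComponent G' m i j k y := by
  have h1 := christoffel_eventuallyEq h
  simp only [curvatureComponent, partialDeriv_congr (h1 _ _ _), (h1 _ _ _).self_of_nhds]

theorem injective_differential {N q : ℕ} {M : Type*} [TopologicalSpace M]
    [ChartedSpace (EuclideanSpace ℝ (Fin N)) M]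
    [RiemannianBundle (fun x : M => TangentSpace (𝓡 N) x)] {f : M → CSpace q}
    (hf : IsIsometricImmersion N f) (x : M) : Function.Injective (differential N f x) := by
  rw [injective_iff_map_eq_zero]
  intro u hu
  have h := hf.isometric x u u
  rw [hu, inner_zero_left] at h
  exact inner_self_eq_zero.1 h.symm

section Submanifold

variable {N q : ℕ} {M : Type*} [TopologicalSpace M] [ChartedSpace (EuclideanSpace ℝ (Fin N)) M]
  [IsManifold (𝓡 N) ∞ M]

theorem contDiffAt_comp_extChartAt_symm {f : M → CSpace q}
    (hf : ContMDiff (𝓡 N) 𝓘(ℝ, CSpace q) ∞ f) (x : M) {y : EuclideanSpace ℝ (Fin N)}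
    (hy : y ∈ (extChartAt (𝓡 N) x).target) :
    ContDiffAt ℝ ∞ (f ∘ (extChartAt (𝓡 N) x).symm) y := by
  have h := hf.comp_contMDiffOn (contMDiffOn_extChartAt_symm (I := 𝓡 N) (n := ∞) x)
  exact (contMDiffOn_iff_contDiffOn.1 h).contDiffAt
    ((isOpen_extChartAt_target x).mem_nhds hy)

theorem mdifferentiableAt_extChartAt_symm (x : M) {y : EuclideanSpace ℝ (Fin N)}
    (hy : y ∈ (extChartAt (𝓡 N) x).target) :
    MDifferentiableAt 𝓘(ℝ, EuclideanSpace ℝ (Fin N)) (𝓡 N) (extChartAt (𝓡 N) x).symm y :=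
  ((contMDiffOn_extChartAt_symm (I := 𝓡 N) (n := ∞) x).contMDiffAt
    ((isOpen_extChartAt_target x).mem_nhds hy)).mdifferentiableAt (by simp)

theorem fderiv_comp_extChartAt_symm {f : M → CSpace q}
    (hf : ContMDiff (𝓡 N) 𝓘(ℝ, CSpace q) ∞ f) (x : M) {y : EuclideanSpace ℝ (Fin N)}
    (hy : y ∈ (extChartAt (𝓡 N) x).target) (v : EuclideanSpace ℝ (Fin N)) :
    fderiv ℝ (f ∘ (extChartAt (𝓡 N) x).symm) y v =
      differential N f ((extChartAt (𝓡 N) x).symm y)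
        (mfderiv 𝓘(ℝ, EuclideanSpace ℝ (Fin N)) (𝓡 N) (extChartAt (𝓡 N) x).symm y v) := by
  rw [← mfderiv_eq_fderiv, mfderiv_comp y ((hf _).mdifferentiableAt (by simp))
    (mdifferentiableAt_extChartAt_symm x hy)]
  rfl

theorem fderiv_comp_extChartAt_symm_self {f : M → CSpace q}
    (hf : ContMDiff (𝓡 N) 𝓘(ℝ, CSpace q) ∞ f) (x : M) (v : EuclideanSpace ℝ (Fin N)) :
    fderiv ℝ (f ∘ (extChartAt (𝓡 N) x).symm) (extChartAt (𝓡 N) x x) v =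
      differential N f x (ofCoordComponents x v) := by
  have hx := (extChartAt (𝓡 N) x).map_source (mem_extChartAt_source (I := 𝓡 N) x)
  -- The chart sends x to its coordinates and back to x only up to a propositional equality, so the
  -- base point is replaced by substitution.
  have h (x' : M) (hx' : x' = x) (w : EuclideanSpace ℝ (Fin N)) :
      differential N f x' w = differential N f x w := by
    subst hx'; rfl
  rw [fderiv_comp_extChartAt_symm hf x hx]
  exact h _ (extChartAt_to_inv x) _

theorem ofCoordComponents_coordComponents (x : M) (u : TangentSpace (𝓡 N) x) :
    ofCoordComponents x (coordComponents x u) = u := by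
  have : IsManifold (𝓡 N) 1 M := IsManifold.of_le (n := ∞) (by simp)
  have h := mfderivWithin_extChartAt_symm_comp_mfderiv_extChartAt' (I := 𝓡 N) (x := x)
    (mem_extChartAt_source x)
  rw [ModelWithCorners.range_eq_univ, mfderivWithin_univ] at h
  exact DFunLike.congr_fun h u

theorem coordComponents_ofCoordComponents (x : M) (c : EuclideanSpace ℝ (Fin N)) :
    coordComponents x (ofCoordComponents x c) = c := by
  have : IsManifold (𝓡 N) 1 M := IsManifold.of_le (n := ∞) (by simp)
  have h := mfderiv_extChartAt_comp_mfderivWithin_extChartAt_symm' (I := 𝓡 N) (x := x)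
    (mem_extChartAt_source x)
  rw [ModelWithCorners.range_eq_univ, mfderivWithin_univ] at h
  exact DFunLike.congr_fun h c

theorem range_fderiv_comp_extChartAt_symm {f : M → CSpace q}
    (hf : ContMDiff (𝓡 N) 𝓘(ℝ, CSpace q) ∞ f) (x : M) :
    LinearMap.range (fderiv ℝ (f ∘ (extChartAt (𝓡 N) x).symm)
      (extChartAt (𝓡 N) x x)).toLinearMap = LinearMap.range (differential N f x) := by
  ext w
  constructor
  · rintro ⟨v, rfl⟩
    exact ⟨_, (fderiv_comp_extChartAt_symm_self hf x v).symm⟩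
  · rintro ⟨u, rfl⟩
    refine ⟨coordComponents x u, ?_⟩
    rw [ContinuousLinearMap.coe_coe, fderiv_comp_extChartAt_symm_self hf,
      ofCoordComponents_coordComponents]

variable [RiemannianBundle (fun x : M => TangentSpace (𝓡 N) x)]

/-- Equality on the whole chart target, not only at the base point, is what lets the derivatives of
the metric be compared. -/
theorem metricCoeff_eq_parametrizationGram {f : M → CSpace q} (hf : IsIsometricImmersion N f)
    (x : M) {y : EuclideanSpace ℝ (Fin N)} (hy : y ∈ (extChartAt (𝓡 N) x).target) :
    metricCoeff x y = parametrizationGram (f ∘ (extChartAt (𝓡 N) x).symm) y := by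
  ext i j
  rw [parametrizationGram_apply, fderiv_comp_extChartAt_symm hf.contMDiff x hy,
    fderiv_comp_extChartAt_symm hf.contMDiff x hy, hf.isometric]
  rfl

theorem det_parametrizationGram_comp_extChartAt_symm_ne_zero {f : M → CSpace q}
    (hf : IsIsometricImmersion N f) (x : M) :
    (parametrizationGram (f ∘ (extChartAt (𝓡 N) x).symm) (extChartAt (𝓡 N) x x)).det ≠ 0 := by
  refine det_parametrizationGram_ne_zero fun v w h => ?_
  rw [fderiv_comp_extChartAt_symm_self hf.contMDiff,
    fderiv_comp_extChartAt_symm_self hf.contMDiff] at h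
  rw [← coordComponents_ofCoordComponents x v, injective_differential hf x h,
    coordComponents_ofCoordComponents]

/-- The Gauss equation for a submanifold of `ℂ^q`. -/
theorem gauss_equation {f : M → CSpace q} (hf : IsIsometricImmersion N f) (x : M)
    (u v w z : TangentSpace (𝓡 N) x) :
    ⟪curvature x u v w, z⟫_ℝ =
      ⟪secondFundamentalForm N f x v w, secondFundamentalForm N f x u z⟫_ℝ -
      ⟪secondFundamentalForm N f x u w, secondFundamentalForm N f x v z⟫_ℝ := by
  have hx := (extChartAt (𝓡 N) x).map_source (mem_extChartAt_source (I := 𝓡 N) x)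
  have hG := Filter.eventually_of_mem ((isOpen_extChartAt_target (I := 𝓡 N) x).mem_nhds hx)
    fun y hy => metricCoeff_eq_parametrizationGram hf x hy
  have h3 : ContDiffAt ℝ 3 (f ∘ (extChartAt (𝓡 N) x).symm) (extChartAt (𝓡 N) x x) :=
    contDiffAt_infty.1 (contDiffAt_comp_extChartAt_symm hf.contMDiff x hx) 3
  have key := gauss_equation_parametrization h3
    (det_parametrizationGram_comp_extChartAt_symm_ne_zero hf x) (coordComponents x u)
    (coordComponents x v) (coordComponents x w) (coordComponents x z)
  simp only [← curvatureComponent_congr hG] at key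
  rw [fderiv_comp_extChartAt_symm_self hf.contMDiff,
    fderiv_comp_extChartAt_symm_self hf.contMDiff, ofCoordComponents_coordComponents,
    hf.isometric] at key
  simp only [range_fderiv_comp_extChartAt_symm hf.contMDiff] at key
  -- The normal projection is self-adjoint and idempotent, so it may be inserted in the second slot
  -- as well.
  have hP (a b : CSpace q) : ⟪(LinearMap.range (differential N f x))ᗮ.starProjection a, b⟫_ℝ =
      ⟪(LinearMap.range (differential N f x))ᗮ.starProjection a,
        (LinearMap.range (differential N f x))ᗮ.starProjection b⟫_ℝ := by
    rw [← Submodule.inner_starProjection_left_eq_right,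
      Submodule.starProjection_eq_self_iff.2 (Submodule.starProjection_apply_mem _ _)]
  exact key.trans (congrArg₂ _ (hP _ _) (hP _ _))

end Submanifold

/-! ### Traces of bilinear maps and vectors with zero sum. -/

section Bilinear

variable {V W : Type*} [NormedAddCommGroup V] [InnerProductSpace ℝ V]

/-- The trace of a vector-valued bilinear map does not depend on the orthonormal basis. -/
theorem OrthonormalBasis.sum_bilin_self_eq [AddCommGroup W] [Module ℝ W]
    {ι ι' : Type*} [Fintype ι] [Fintype ι']
    (b : OrthonormalBasis ι ℝ V) (b' : OrthonormalBasis ι' ℝ V) (B : V →ₗ[ℝ] V →ₗ[ℝ] W) :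
    ∑ i, B (b i) (b i) = ∑ j, B (b' j) (b' j) := by
  classical
  -- Expanding in `b'` and then summing over `b` reduces the coefficients to ⟪b' j, b' k⟫, hence to
  -- the diagonal terms.
  have h (i : ι) : B (b i) (b i) =
      ∑ j, ∑ k, (⟪b' j, b i⟫_ℝ * ⟪b i, b' k⟫_ℝ) • B (b' j) (b' k) := by
    conv_lhs => rw [← b'.sum_repr' (b i)]
    simp only [map_sum, map_smul, LinearMap.sum_apply, LinearMap.smul_apply, Finset.smul_sum,
      smul_smul]
    rw [Finset.sum_comm]
    refine Finset.sum_congr rfl fun j _ => Finset.sum_congr rfl fun k _ => ?_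
    rw [real_inner_comm (b i) (b' k), mul_comm]
  simp only [h]
  rw [Finset.sum_comm]
  refine Finset.sum_congr rfl fun j _ => ?_
  rw [Finset.sum_comm]
  simp only [← Finset.sum_smul, b.sum_inner_mul_inner]
  simp [orthonormal_iff_ite.1 b'.orthonormal]

variable [FiniteDimensional ℝ V]

/-- The trace of a bilinear map over an orthogonal sum is the sum of the traces. -/
theorem sum_bilin_stdOrthonormalBasis_of_orthogonal [AddCommGroup W] [Module ℝ W]
    {ι : Type*} [Fintype ι] (B : V →ₗ[ℝ] V →ₗ[ℝ] W)
    {D : Submodule ℝ V} {U : ι → Submodule ℝ V} (hle : ∀ i, U i ≤ D)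
    (horth : ∀ i j, i ≠ j → U i ⟂ U j)
    (hdim : ∑ i, Module.finrank ℝ (U i) = Module.finrank ℝ D) :
    ∑ i, ∑ a, B (stdOrthonormalBasis ℝ (U i) a : V) (stdOrthonormalBasis ℝ (U i) a : V) =
      ∑ a, B (stdOrthonormalBasis ℝ D a : V) (stdOrthonormalBasis ℝ D a : V) := by
  classical
  have hfam : OrthogonalFamily ℝ (fun i => U i) fun i => (U i).subtypeₗᵢ :=
    OrthogonalFamily.of_pairwise fun i j hij => horth i j hij
  have hon := hfam.orthonormal_sigma_orthonormal
    (v_family := fun i => stdOrthonormalBasis ℝ (U i))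
    fun i => (stdOrthonormalBasis ℝ (U i)).orthonormal
  -- The bases of the pieces together form an orthonormal family in `D`; the dimension count makes
  -- it a basis.
  let v : (Σ i, Fin (Module.finrank ℝ (U i))) → D := fun p =>
    ⟨stdOrthonormalBasis ℝ (U p.1) p.2, hle _ (stdOrthonormalBasis ℝ (U p.1) p.2).2⟩
  have hv : Orthonormal ℝ v := by
    rw [← D.subtypeₗᵢ.orthonormal_comp_iff]
    exact hon
  let b : OrthonormalBasis _ ℝ D := OrthonormalBasis.mk hv
    (hv.linearIndependent.span_eq_top_of_card_eq_finrank' (by simpa using hdim)).ge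
  have h := b.sum_bilin_self_eq (stdOrthonormalBasis ℝ D) (B.domRestrict₁₂ D D)
  rw [Fintype.sum_sigma] at h
  simp only [b, OrthonormalBasis.coe_mk] at h
  exact h

/-- If vectors sum to zero, then the sum of their pairwise inner products is nonpositive. -/
theorem sum_sum_Ioi_inner_nonpos {W ι : Type*} [NormedAddCommGroup W] [InnerProductSpace ℝ W]
    [Fintype ι] [LinearOrder ι] [LocallyFiniteOrderTop ι] [LocallyFiniteOrderBot ι]
    (H : ι → W) (h : ∑ i, H i = 0) :
    ∑ i, ∑ j ∈ Finset.Ioi i, ⟪H i, H j⟫_ℝ ≤ 0 := by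
  -- The off-diagonal sum is twice the required one, and equals |∑ H i|² = 0 minus the sum of the |H
  -- i|².
  have h1 := Finset.sum_sum_Ioi_add_eq_sum_sum_off_diag fun i j => ⟪H i, H j⟫_ℝ
  have h2 : ∑ i, ∑ j, ⟪H j, H i⟫_ℝ = 0 := by simp [← sum_inner, h]
  have h3 (i : ι) : ∑ j ∈ {i}ᶜ, ⟪H j, H i⟫_ℝ = ∑ j, ⟪H j, H i⟫_ℝ - ⟪H i, H i⟫_ℝ := by
    rw [← Finset.sum_compl_add_sum {i} (fun j => ⟪H j, H i⟫_ℝ), Finset.sum_singleton,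
      add_sub_cancel_right]
  have h4 : ∑ i, ∑ j ∈ {i}ᶜ, ⟪H j, H i⟫_ℝ ≤ 0 := by
    simp only [h3, Finset.sum_sub_distrib, h2, zero_sub, Left.neg_nonpos_iff]
    exact Finset.sum_nonneg fun i _ => real_inner_self_nonneg
  have h5 : ∑ i, ∑ j ∈ Finset.Ioi i, (⟪H j, H i⟫_ℝ + ⟪H i, H j⟫_ℝ) =
      2 * ∑ i, ∑ j ∈ Finset.Ioi i, ⟪H i, H j⟫_ℝ := by
    simp only [real_inner_comm, ← two_mul, ← Finset.mul_sum]
  linarith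

end Bilinear

/-! ### Bounding the mutual curvature by mean curvature vectors. -/

section MutualCurvature

variable {N q : ℕ} {M : Type*} [TopologicalSpace M] [ChartedSpace (EuclideanSpace ℝ (Fin N)) M]

theorem coordComponents_add (x : M) (u v : TangentSpace (𝓡 N) x) :
    coordComponents x (u + v) = coordComponents x u + coordComponents x v :=
  map_add (mfderiv (𝓡 N) 𝓘(ℝ, EuclideanSpace ℝ (Fin N)) (extChartAt (𝓡 N) x) x) u v

theorem coordComponents_smul (x : M) (c : ℝ) (u : TangentSpace (𝓡 N) x) :
    coordComponents x (c • u) = c • coordComponents x u :=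
  map_smul (mfderiv (𝓡 N) 𝓘(ℝ, EuclideanSpace ℝ (Fin N)) (extChartAt (𝓡 N) x) x) c u

theorem secondFundamentalForm_add_left (f : M → CSpace q) (x : M) (u v w : TangentSpace (𝓡 N) x) :
    secondFundamentalForm N f x (u + v) w =
      secondFundamentalForm N f x u w + secondFundamentalForm N f x v w := by
  simp only [secondFundamentalForm, coordComponents_add, map_add, add_apply]

theorem secondFundamentalForm_smul_left (f : M → CSpace q) (x : M) (c : ℝ)
    (u w : TangentSpace (𝓡 N) x) :
    secondFundamentalForm N f x (c • u) w = c • secondFundamentalForm N f x u w := by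
  simp only [secondFundamentalForm, coordComponents_smul, map_smul, smul_apply]

theorem secondFundamentalForm_add_right (f : M → CSpace q) (x : M) (u v w : TangentSpace (𝓡 N) x) :
    secondFundamentalForm N f x u (v + w) =
      secondFundamentalForm N f x u v + secondFundamentalForm N f x u w := by
  simp only [secondFundamentalForm, coordComponents_add, map_add]

theorem secondFundamentalForm_smul_right (f : M → CSpace q) (x : M) (c : ℝ)
    (u w : TangentSpace (𝓡 N) x) :
    secondFundamentalForm N f x u (c • w) = c • secondFundamentalForm N f x u w := by
  simp only [secondFundamentalForm, coordComponents_smul, map_smul]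

section

variable [RiemannianBundle (fun x : M => TangentSpace (𝓡 N) x)]

theorem sum_meanCurvature_of_orthogonal (f : M → CSpace q) (x : M)
    {D : Submodule ℝ (TangentSpace (𝓡 N) x)} {k : ℕ}
    {V : Fin k → Submodule ℝ (TangentSpace (𝓡 N) x)} (hle : ∀ i, V i ≤ D)
    (horth : ∀ i j, i ≠ j → V i ⟂ V j)
    (hdim : ∑ i, Module.finrank ℝ (V i) = Module.finrank ℝ D) :
    ∑ i, meanCurvature N f x (V i) = meanCurvature N f x D := by
  let B : TangentSpace (𝓡 N) x →ₗ[ℝ] TangentSpace (𝓡 N) x →ₗ[ℝ] CSpace q :=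
    LinearMap.mk₂ ℝ (secondFundamentalForm N f x) (secondFundamentalForm_add_left f x)
      (secondFundamentalForm_smul_left f x) (secondFundamentalForm_add_right f x)
      (secondFundamentalForm_smul_right f x)
  have h := sum_bilin_stdOrthonormalBasis_of_orthogonal B hle horth hdim
  exact h

end

variable [IsManifold (𝓡 N) ∞ M]

theorem secondFundamentalForm_comm {f : M → CSpace q}
    (hf : ContMDiff (𝓡 N) 𝓘(ℝ, CSpace q) ∞ f) (x : M) (u v : TangentSpace (𝓡 N) x) :
    secondFundamentalForm N f x u v = secondFundamentalForm N f x v u := by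
  have hx := (extChartAt (𝓡 N) x).map_source (mem_extChartAt_source (I := 𝓡 N) x)
  have hs : IsSymmSndFDerivAt ℝ (f ∘ (extChartAt (𝓡 N) x).symm) (extChartAt (𝓡 N) x x) :=
    (contDiffAt_infty.1 (contDiffAt_comp_extChartAt_symm hf x hx) 2).isSymmSndFDerivAt (by simp)
  rw [secondFundamentalForm, hs.eq]
  rfl

variable [RiemannianBundle (fun x : M => TangentSpace (𝓡 N) x)]

/-- By the Gauss equation the two sides differ by the sum of the |h(e_a, e_b)|². -/
theorem mutualCurvaturePair_le_inner_meanCurvature {f : M → CSpace q}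
    (hf : IsIsometricImmersion N f) (x : M) (V W : Submodule ℝ (TangentSpace (𝓡 N) x)) :
    mutualCurvaturePair x V W ≤ ⟪meanCurvature N f x V, meanCurvature N f x W⟫_ℝ := by
  rw [mutualCurvaturePair, meanCurvature, meanCurvature, sum_inner]
  refine Finset.sum_le_sum fun a _ => ?_
  rw [inner_sum]
  refine Finset.sum_le_sum fun b _ => ?_
  rw [gauss_equation hf, secondFundamentalForm_comm hf.contMDiff x
    (stdOrthonormalBasis ℝ W b : TangentSpace (𝓡 N) x) (stdOrthonormalBasis ℝ V a),
    real_inner_comm]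
  exact sub_le_self _ real_inner_self_nonneg

/-- For an orthogonal decomposition of a subspace with vanishing mean curvature, the mutual
curvature is nonpositive. -/
theorem mutualCurvature_nonpos {f : M → CSpace q} (hf : IsIsometricImmersion N f) (x : M)
    {D : Submodule ℝ (TangentSpace (𝓡 N) x)} (hD : meanCurvature N f x D = 0) {k : ℕ}
    {V : Fin k → Submodule ℝ (TangentSpace (𝓡 N) x)} (hle : ∀ i, V i ≤ D)
    (horth : ∀ i j, i ≠ j → V i ⟂ V j)
    (hdim : ∑ i, Module.finrank ℝ (V i) = Module.finrank ℝ D) :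
    mutualCurvature x V ≤ 0 :=
  (Finset.sum_le_sum fun i _ => Finset.sum_le_sum fun j _ =>
    mutualCurvaturePair_le_inner_meanCurvature hf x (V i) (V j)).trans
    (sum_sum_Ioi_inner_nonpos _ (by rw [sum_meanCurvature_of_orthogonal f x hle horth hdim, hD]))

theorem nonpos_of_mem_mutualCurvatureValues {f : M → CSpace q} (hf : IsIsometricImmersion N f)
    (x : M) {D : Submodule ℝ (TangentSpace (𝓡 N) x)} (hD : meanCurvature N f x D = 0) {k : ℕ}
    {n : Fin k → ℕ} (hn : ∑ i, n i = Module.finrank ℝ D) {s : ℝ}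
    (hs : s ∈ mutualCurvatureValues x D n) : s ≤ 0 := by
  obtain ⟨V, hle, horth, hdim, rfl⟩ := hs
  exact mutualCurvature_nonpos hf x hD hle horth (by simp only [hdim, hn])

end MutualCurvature

/-! ### Extracting information from a positive infimum, and the conclusion. -/

/-- A real set unbounded below has `sInf` equal to 0 by convention, so positivity already forces
boundedness. -/
theorem pos_of_mem_of_pos_sInf {s : Set ℝ} (h : 0 < sInf s) {a : ℝ} (ha : a ∈ s) : 0 < a := by
  have hb : BddBelow s := by
    by_contra hs
    simp [Real.sInf_of_not_bddBelow hs] at h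
  exact h.trans_le (csInf_le hb ha)

/-- The empty set also has `sInf` equal to 0, so positivity yields an element. -/
theorem exists_mem_of_pos_sInf {s : Set ℝ} (h : 0 < sInf s) : ∃ a ∈ s, 0 < a := by
  obtain ⟨a, ha⟩ : s.Nonempty := by
    by_contra hs
    simp [Set.not_nonempty_iff_eq_empty.1 hs] at h
  exact ⟨a, ha, pos_of_mem_of_pos_sInf h ha⟩

theorem mainTheorem8 {q d l : ℕ} {M : Type*} [TopologicalSpace M]
    [ChartedSpace (EuclideanSpace ℝ (Fin (d + l))) M] [IsManifold (𝓡 (d + l)) ∞ M]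
    [RiemannianBundle (fun x : M => TangentSpace (𝓡 (d + l)) x)]
    [IsContMDiffRiemannianBundle (𝓡 (d + l)) ∞ (EuclideanSpace ℝ (Fin (d + l)))
      (fun x : M => TangentSpace (𝓡 (d + l)) x)]
    (f : M → CSpace q) (hCR : IsCRSubmanifold d l f) (hmin : IsDMinimal (d + l) f) :
    (¬ ∃ (k : ℕ) (n : Fin k → ℕ) (x : M), 2 ≤ k ∧ ∑ i, n i = d ∧
        0 < deltaPlus x (holomorphicTangent (d + l) f x) n) ∧
    (¬ ∃ (k : ℕ) (x : M), 2 ≤ k ∧ k ≤ d ∧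
        0 < deltaMinusMin x (holomorphicTangent (d + l) f x) k) := by
  constructor
  · rintro ⟨k, n, x, -, hn, hpos⟩
    -- This bound needs no attained maximum: the default value 0 of `sSup` is nonpositive too.
    refine hpos.not_ge (Real.sSup_nonpos fun s hs => ?_)
    exact nonpos_of_mem_mutualCurvatureValues hCR.isometricImmersion x (hmin x)
      (hn.trans (hCR.finrank_eq x).symm) hs
  · rintro ⟨k, x, hk, hkd, hpos⟩
    obtain ⟨n, hn0, hn⟩ : ∃ n : Fin k → ℕ, (∀ i, 0 < n i) ∧ ∑ i, n i = d := by
      obtain ⟨m, rfl⟩ : ∃ m, k = m + 1 := ⟨k - 1, by omega⟩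
      -- One block of dimension d - k + 1 and k - 1 lines fill D; the first block is nonzero because
      -- k ≤ d.
      refine ⟨Fin.cons (d - m) fun _ => 1, fun i => ?_, ?_⟩
      · refine Fin.cases ?_ (fun i => ?_) i
        · simp; omega
        · simp
      · simp [Fin.sum_univ_succ]; omega
    have hn' := hn.trans (hCR.finrank_eq x).symm
    -- The full partition is one of the competitors in the minimum over dimension sums at most d, so
    -- its own invariant is positive.
    have h1 := pos_of_mem_of_pos_sInf hpos ⟨n, hn0, hn'.le, rfl⟩
    obtain ⟨s, hs, hs0⟩ := exists_mem_of_pos_sInf h1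
    exact hs0.not_ge
      (nonpos_of_mem_mutualCurvatureValues hCR.isometricImmersion x (hmin x) hn' hs)
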